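/- For $n\ge 0$ and $r\ge 1$ let $H_n^{(r)}=\sum_{i=1}^n i^{-r}$ (so $H_0^{(r)}=0$) and $H_n=H_n^{(1)}$. Let $P_k$ and $Q_k$ be the polynomials with rational coefficients expressing the elementary symmetric function $e_k$ and the complete symmetric function $h_k$ through the power sums, $e_k=P_k(p_1,\dots,p_k)$ and $h_k=Q_k(p_1,\dots,p_k)$; explicitly, \[ P_k(y_1,\dots,y_k)=\sum_{m_1+2m_2+\cdots=k}\frac{(-1)^{m_2+m_4+\cdots}}{m_1!\,m_2!\cdots}\Bigl(\frac{y_1}{1}\Bigr)^{m_1}\Bigl(\frac{y_2}{2}\Bigr)^{m_2}\cdots,\qquad Q_k(y_1,\dots,y_k)=\sum_{m_1+2m_2+\cdots=k}\frac{1}{m_1!\,m_2!\cdots}\Bigl(\frac{y_1}{1}\Bigr)^{m_1}\Bigl(\frac{y_2}{2}\Bigr)^{m_2}\cdots, \] with $P_0=Q_0=1$. For positive integers $i_1,\dots,i_d$ with $i_1>1$ let \[ \zeta(i_1,\dots,i_d)=\sum_{n_1>n_2>\cdots>n_d\ge 1}\frac{1}{n_1^{i_1}n_2^{i_2}\cdots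 n_d^{i_d}} \] be the multiple zeta value of weight $i_1+\cdots+i_d$ and depth $d$, and let $S^R_{w,d}$ be the sum of all multiple zeta values of weight $w$ and depth $d$ whose exponent string ends in $1$ (that is, $i_1>1$ and $i_d=1$). Theorem. For all nonnegative integers $l,k$ the following series converges and \[ \sum_{n=0}^\infty \frac{Q_l\bigl(H_n,H_n^{(2)},\dots,H_n^{(l)}\bigr)\,P_k\bigl(H_n,H_n^{(2)},\dots,H_n^{(k)}\bigr)}{(n+1)^2} =\binom{l+k+1}{k+1}\zeta(l+k+2)-\sum_{p=k}^{l+k-1}\binom{p}{k}\,S^R_{l+k+2,\;l+k+1-p}, \] where the last sum is empty (equal to $0$) if $l=0$. -/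

import Mathlib

open Finset

noncomputable section

/-- The polynomial `P_n(y_1, …, y_n)` expressing the elementary symmetric function `e_n` in the
power sums `y_i = p_i`: the sum over `m_1 + 2 m_2 + ⋯ = n` of
`(-1)^(m_2 + m_4 + ⋯) / (m_1! m_2! ⋯) * (y_1 / 1)^(m_1) * (y_2 / 2)^(m_2) * ⋯`.
The solutions `m` are the partitions of `n`, with `m_i` the multiplicity of the part `i`;
the variable `y_i` is `X i`. -/
def elemPoly (n : ℕ) : MvPolynomial ℕ ℚ :=
  ∑ c : Nat.Partition n,
    (-1) ^ (∑ i ∈ (Icc 1 n).filter Even, c.parts.count i) *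
      ∏ i ∈ Icc 1 n,
        (MvPolynomial.C (1 / ((c.parts.count i).factorial : ℚ)) *
          (MvPolynomial.C (1 / (i : ℚ)) * MvPolynomial.X i) ^ c.parts.count i)

/-- The polynomial `Q_n(y_1, …, y_n)` expressing the complete symmetric function `h_n` in the
power sums `y_i = p_i`: the same sum as for `P_n`, without the signs. -/
def complPoly (n : ℕ) : MvPolynomial ℕ ℚ :=
  ∑ c : Nat.Partition n,
    ∏ i ∈ Icc 1 n,
      (MvPolynomial.C (1 / ((c.parts.count i).factorial : ℚ)) *
        (MvPolynomial.C (1 / (i : ℚ)) * MvPolynomial.X i) ^ c.parts.count i)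

/-- The generalized harmonic number `H_n^{(r)} = ∑_{i=1}^n 1 / i^r`; it is `0` for `n = 0`. -/
def genHarmonic (n r : ℕ) : ℝ := ∑ i ∈ Icc 1 n, 1 / (i : ℝ) ^ r

/-- The multiple zeta value `ζ(i_1, …, i_d) = ∑_{n_1 > ⋯ > n_d ≥ 1} 1 / (n_1^{i_1} ⋯ n_d^{i_d})`.
The exponents are `i 0, …, i (d - 1)`, the largest summation variable carrying `i 0`. -/
def multiZeta {d : ℕ} (i : Fin d → ℕ) : ℝ :=
  ∑' n : {n : Fin d → ℕ // StrictAnti n ∧ ∀ j, 1 ≤ n j}, ∏ j, 1 / (n.1 j : ℝ) ^ i j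

/-- The exponent strings `(i_1, …, i_d)` of positive integers with `i_1 > 1`, of weight
`i_1 + ⋯ + i_d = w` and depth `d`, whose last entry is `1`. -/
def stringsEndingInOne (w d : ℕ) : Finset (Fin d → ℕ) :=
  (Finset.Nat.antidiagonalTuple d w).filter fun i =>
    (∀ j, 1 ≤ i j) ∧ (∀ j : Fin d, j.val = 0 → 1 < i j) ∧ (∀ j : Fin d, j.val + 1 = d → i j = 1)

/-- `S^R_{w,d}`: the sum of all multiple zeta values of weight `w` and depth `d` whose exponent
string ends in `1`. -/
def SR (w d : ℕ) : ℝ := ∑ i ∈ stringsEndingInOne w d, multiZeta i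

end

/-! Since `Q_l` and `P_k` at the harmonic numbers are `h_l` and `e_k` of `1, 1/2, …, 1/n`, their
products have the generating function `∏_{m ≤ n} (1 + y/m) / (1 - x/m) = ∏_{m ≤ n} (1 + z/(m - x))`
with `z = x + y`. If `c_n(i,j)` is the coefficient of `x^i z^j` on the right, expanding `(x + y)^j`
gives `h_l e_k = ∑_{i+j=l+k} C(j,k) c_n(i,j)` (`chooseSum_chainCoeff`). It remains to evaluate `∑_n
c_n(i,j)/(n+1)²`: it is `ζ(j+2)` for `i = 0`, and `ζ(i+j+2) - S^R_{i+j+2, i+1}` for `i ≥ 1`. The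
zeta terms then add up by the hockey-stick identity.

Both ingredients of the evaluation are connected sums. With `f(n) = ∏_{i ≤ n} (i - z)`, now for a
real parameter `0 ≤ z < 1`, the connector `C(m,n) = f(m) f(n) / f(m+n)` satisfies the transport
relation `∑_{n > a} C(m,n)/(n - z) = C(m,a)/m` for `m > 0`, by telescoping. Transporting the factors
`1/m` one at a time and comparing coefficients in `z` proves the sum theorem (`truncSum_zero`). At
`z = 0` the same relation turns the series of the `c_n(i,j)` into sums of multiple zeta values of
fixed weight and depth, minus those whose last exponent is `1` (`chainSeries_succ_add`).

Infinite sums are handled in `ℝ≥0∞`, where they may be interchanged freely; finiteness follows at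
the end from that of `ζ`. -/

open scoped NNReal ENNReal

/-! ### Partition polynomials and Newton's recursion -/

/-- The weight `∏ (1 / m_i!) (y_i / i) ^ m_i` of a multiset, where `m_i` is the multiplicity of `i`
and `i` ranges over `1, …, K`. -/
noncomputable def multisetWeight (y : ℕ → ℝ) (K : ℕ) (s : Multiset ℕ) : ℝ :=
  ∏ i ∈ Icc 1 K, (1 / ((s.count i).factorial : ℝ)) * (1 / (i : ℝ) * y i) ^ s.count i

theorem multisetWeight_mono (y : ℕ → ℝ) {K L : ℕ} (h : K ≤ L) (s : Multiset ℕ)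
    (hs : ∀ i ∈ s, i ≤ K) : multisetWeight y L s = multisetWeight y K s := by
  unfold multisetWeight
  symm
  apply Finset.prod_subset (Finset.Icc_subset_Icc_right h)
  intro i hi hi'
  have : i ∉ s := fun hm => hi' (by
    rw [Finset.mem_Icc] at hi ⊢
    exact ⟨hi.1, hs i hm⟩)
  simp [Multiset.count_eq_zero_of_notMem this]

/-- The factor `i * m_i` cancels one factor of `m_i!` and one of `i ^ m_i`. -/
theorem multisetWeight_cons (y : ℕ → ℝ) {K i : ℕ} (hi : i ∈ Icc 1 K) (s : Multiset ℕ) :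
    (i : ℝ) * ((i ::ₘ s).count i : ℝ) * multisetWeight y K (i ::ₘ s) =
      y i * multisetWeight y K s := by
  unfold multisetWeight
  rw [← Finset.mul_prod_erase _ _ hi, ← Finset.mul_prod_erase (Icc 1 K)
    (fun j => (1 / ((s.count j).factorial : ℝ)) * (1 / (j : ℝ) * y j) ^ s.count j) hi]
  have h : ∀ j ∈ (Icc 1 K).erase i, (i ::ₘ s).count j = s.count j := fun j hj =>
    Multiset.count_cons_of_ne (Finset.ne_of_mem_erase hj) s
  rw [Finset.prod_congr rfl fun j hj => by rw [h j hj]]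
  have h0 : (i : ℝ) ≠ 0 := by
    have := (Finset.mem_Icc.1 hi).1
    positivity
  have h1 : ((s.count i).factorial : ℝ) ≠ 0 := by positivity
  have h2 : ((s.count i : ℝ) + 1) ≠ 0 := by positivity
  rw [Multiset.count_cons_self, Nat.factorial_succ]
  push_cast
  field_simp
  rw [pow_succ]
  field_simp

theorem aeval_complPoly (y : ℕ → ℝ) (k : ℕ) :
    MvPolynomial.aeval y (complPoly k) = ∑ c : Nat.Partition k, multisetWeight y k c.parts := by
  simp [complPoly, multisetWeight, map_sum, map_prod]

theorem le_of_mem_partition {k : ℕ} (c : Nat.Partition k) {i : ℕ} (hi : i ∈ c.parts) : i ≤ k :=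
  (Multiset.le_sum_of_mem hi).trans_eq c.parts_sum

/-- Removing one part `i` is a bijection from the partitions of `k` containing `i` to the partitions
of `k - i`; the others have multiplicity zero. -/
theorem sum_count_mul_multisetWeight (y : ℕ → ℝ) {k i : ℕ} (hi : i ∈ Icc 1 k) :
    ∑ c : Nat.Partition k, (i : ℝ) * (c.parts.count i : ℝ) * multisetWeight y k c.parts =
      y i * MvPolynomial.aeval y (complPoly (k - i)) := by
  have hik := Finset.mem_Icc.1 hi
  rw [aeval_complPoly, Finset.mul_sum,
    ← Finset.sum_filter_add_sum_filter_not univ (fun c : Nat.Partition k => i ∈ c.parts)]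
  rw [Finset.sum_eq_zero (s := univ.filter fun c : Nat.Partition k => ¬ i ∈ c.parts), add_zero]
  · refine Finset.sum_bij'
      (fun c hc => (⟨c.parts.erase i, fun hj => c.parts_pos (Multiset.mem_of_mem_erase hj), by
        have h := Multiset.sum_erase (Finset.mem_filter.1 hc).2
        rw [c.parts_sum] at h
        omega⟩ : Nat.Partition (k - i)))
      (fun c _ => (⟨i ::ₘ c.parts, fun hj => by
          rcases Multiset.mem_cons.1 hj with rfl | hj
          · exact hik.1
          · exact c.parts_pos hj, by
        rw [Multiset.sum_cons, c.parts_sum]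
        omega⟩ : Nat.Partition k)) ?_ ?_ ?_ ?_ ?_
    · intro c hc
      exact mem_univ _
    · intro c hc
      simp
    · intro c hc
      ext1
      exact Multiset.cons_erase (Finset.mem_filter.1 hc).2
    · intro c hc
      ext1
      exact Multiset.erase_cons_head _ _
    · intro c hc
      dsimp only
      rw [← multisetWeight_mono y (Nat.sub_le k i), ← multisetWeight_cons y hi,
        Multiset.cons_erase (Finset.mem_filter.1 hc).2]
      intro j hj
      have h := Multiset.sum_erase (Finset.mem_filter.1 hc).2
      rw [c.parts_sum] at h
      have := Multiset.le_sum_of_mem hj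
      omega
  · intro c hc
    simp [Multiset.count_eq_zero_of_notMem (Finset.mem_filter.1 hc).2]

/-- Newton's recursion for the polynomials expressing complete symmetric functions in power
sums. -/
theorem mul_aeval_complPoly (y : ℕ → ℝ) (k : ℕ) :
    (k : ℝ) * MvPolynomial.aeval y (complPoly k) =
      ∑ i ∈ Icc 1 k, y i * MvPolynomial.aeval y (complPoly (k - i)) := by
  rw [← Finset.sum_congr rfl fun i hi => sum_count_mul_multisetWeight y hi, Finset.sum_comm,
    aeval_complPoly, Finset.mul_sum]
  refine Finset.sum_congr rfl fun c _ => ?_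
  rw [← Finset.sum_mul]
  congr 1
  -- For each partition of `k` the coefficients `i * m_i` add up to `k`.
  have h := Finset.sum_multiset_count_of_subset c.parts (Icc 1 k) (fun i hi => by
    rw [Multiset.mem_toFinset] at hi
    exact Finset.mem_Icc.2 ⟨c.parts_pos hi, le_of_mem_partition c hi⟩)
  rw [c.parts_sum] at h
  conv_lhs => rw [h]
  push_cast
  exact Finset.sum_congr rfl fun i _ => by simp [mul_comm]

/-- The sign of a partition is absorbed by negating the variables of even index. -/
theorem aeval_elemPoly (y : ℕ → ℝ) (k : ℕ) :
    MvPolynomial.aeval y (elemPoly k) =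
      MvPolynomial.aeval (fun i => -((-1) ^ i * y i)) (complPoly k) := by
  rw [aeval_complPoly]
  simp only [elemPoly, multisetWeight, map_sum, map_prod, map_mul, map_pow, map_neg, map_one]
  refine Finset.sum_congr rfl fun c _ => ?_
  rw [← Finset.prod_pow_eq_pow_sum, Finset.prod_filter, ← Finset.prod_mul_distrib]
  refine Finset.prod_congr rfl fun i _ => ?_
  rcases Nat.even_or_odd i with h | h
  · simp only [h, h.neg_one_pow, if_true, MvPolynomial.aeval_X, MvPolynomial.aeval_C, one_mul,
      mul_neg]
    rw [neg_pow (1 / (i : ℝ) * y i)]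
    simp
    ring
  · simp [h.neg_one_pow, Nat.not_even_iff_odd.2 h]

/-- A sequence satisfying Newton's recursion is given by the partition polynomials. -/
theorem aeval_complPoly_eq_of_newton (y a : ℕ → ℝ) (h0 : a 0 = 1)
    (h : ∀ k : ℕ, (k : ℝ) * a k = ∑ i ∈ Icc 1 k, y i * a (k - i)) (k : ℕ) :
    MvPolynomial.aeval y (complPoly k) = a k := by
  induction k using Nat.strong_induction_on with
  | _ k ih =>
    rcases Nat.eq_zero_or_pos k with rfl | hk
    · rw [h0, aeval_complPoly]
      simp [multisetWeight]
    · have hk' : (k : ℝ) ≠ 0 := by positivity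
      apply mul_left_cancel₀ hk'
      rw [mul_aeval_complPoly, h]
      refine Finset.sum_congr rfl fun i hi => ?_
      rw [ih (k - i) (by have := Finset.mem_Icc.1 hi; omega)]

/-! ### Generating series of the symmetric functions of `1, 1/2, …, 1/n` -/

/-- The power series `∑_{i ≥ 1} y_i X^i`. -/
noncomputable def powerSumSeries (y : ℕ → ℝ) : PowerSeries ℝ :=
  PowerSeries.mk fun i => if i = 0 then 0 else y i

/-- Newton's recursion is the coefficientwise form of `X A' = p A`, so the logarithmic derivative
determines `A`. -/
theorem aeval_complPoly_eq_coeff (y : ℕ → ℝ) (A : PowerSeries ℝ) (h0 : PowerSeries.coeff 0 A = 1)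
    (h : PowerSeries.X * PowerSeries.derivative ℝ A = powerSumSeries y * A) (k : ℕ) :
    MvPolynomial.aeval y (complPoly k) = PowerSeries.coeff k A := by
  refine aeval_complPoly_eq_of_newton y (fun k => PowerSeries.coeff k A) h0 (fun k => ?_) k
  have h1 := congrArg (PowerSeries.coeff k) h
  have h2 : PowerSeries.coeff k (PowerSeries.X * PowerSeries.derivative ℝ A) =
      (k : ℝ) * PowerSeries.coeff k A := by
    cases k with
    | zero => simp
    | succ k =>
      rw [PowerSeries.coeff_succ_X_mul, PowerSeries.coeff_derivative]
      push_cast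
      ring
  rw [← h2, h1, PowerSeries.coeff_mul,
    Finset.Nat.sum_antidiagonal_eq_sum_range_succ_mk]
  symm
  -- The extra index `0` contributes nothing, because `powerSumSeries` has zero constant term.
  apply Finset.sum_subset_zero_on_sdiff
  · intro i hi
    have := Finset.mem_Icc.1 hi
    simp; omega
  · intro i hi
    have : i = 0 := by
      simp at hi
      omega
    simp [this, powerSumSeries]
  · intro i hi
    have := Finset.mem_Icc.1 hi
    have : i ≠ 0 := by omega
    simp [powerSumSeries, this]

theorem powerSumSeries_add (y z : ℕ → ℝ) :
    powerSumSeries (fun i => y i + z i) = powerSumSeries y + powerSumSeries z := by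
  ext i
  by_cases h : i = 0 <;> simp [powerSumSeries, h]

theorem powerSumSeries_neg (y : ℕ → ℝ) :
    powerSumSeries (fun i => -y i) = -powerSumSeries y := by
  ext i
  by_cases h : i = 0 <;> simp [powerSumSeries, h]

theorem powerSumSeries_pow (a : ℝ) :
    powerSumSeries (fun i => a ^ i) * (1 - PowerSeries.C a * PowerSeries.X) =
      PowerSeries.C a * PowerSeries.X := by
  ext i
  rw [mul_sub, mul_one, ← mul_assoc, mul_comm _ (PowerSeries.C a), mul_assoc]
  rcases i with _ | _ | i
  · simp [powerSumSeries]
  · simp [powerSumSeries, PowerSeries.coeff_succ_mul_X]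
  · simp [powerSumSeries, PowerSeries.coeff_succ_mul_X]
    ring

/-- The generating function `∏_{i ≤ n} (1 - X / i)⁻¹` of the complete symmetric functions of
`1, 1/2, …, 1/n`. -/
noncomputable def complSeries : ℕ → PowerSeries ℝ
  | 0 => 1
  | n + 1 => complSeries n * PowerSeries.mk fun i => (1 / ((n : ℝ) + 1)) ^ i

/-- The generating function `∏_{i ≤ n} (1 + X / i)` of the elementary symmetric functions of
`1, 1/2, …, 1/n`. -/
noncomputable def elemSeries : ℕ → PowerSeries ℝ
  | 0 => 1
  | n + 1 => elemSeries n * (1 + PowerSeries.C (1 / ((n : ℝ) + 1)) * PowerSeries.X)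

theorem mk_pow_mul_one_sub (a : ℝ) :
    (PowerSeries.mk fun i => a ^ i) * (1 - PowerSeries.C a * PowerSeries.X) = 1 := by
  ext i
  rw [mul_sub, mul_one, ← mul_assoc, mul_comm _ (PowerSeries.C a), mul_assoc]
  rcases i with _ | i
  · simp
  · simp [PowerSeries.coeff_succ_mul_X, PowerSeries.coeff_one, pow_succ']

theorem complSeries_succ_mul (n : ℕ) :
    complSeries (n + 1) * (1 - PowerSeries.C (1 / ((n : ℝ) + 1)) * PowerSeries.X) =
      complSeries n := by
  rw [complSeries, mul_assoc, mk_pow_mul_one_sub, mul_one]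

theorem one_sub_C_mul_X_ne_zero (a : ℝ) :
    (1 - PowerSeries.C a * PowerSeries.X : PowerSeries ℝ) ≠ 0 := fun h => by
  simpa using congrArg (PowerSeries.coeff 0) h

theorem genHarmonic_succ (n r : ℕ) :
    genHarmonic (n + 1) r = genHarmonic n r + (1 / ((n : ℝ) + 1)) ^ r := by
  rw [genHarmonic, Finset.sum_Icc_succ_top (by omega)]
  simp [genHarmonic]

theorem X_mul_derivative_complSeries (n : ℕ) :
    PowerSeries.X * PowerSeries.derivative ℝ (complSeries n) =
      powerSumSeries (genHarmonic n) * complSeries n := by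
  induction n with
  | zero =>
    have : powerSumSeries (genHarmonic 0) = 0 := by
      ext i
      simp [powerSumSeries, genHarmonic]
    simp [this, complSeries]
  | succ n ih =>
    set a : ℝ := 1 / ((n : ℝ) + 1) with ha
    have h1 := complSeries_succ_mul n
    rw [← ha] at h1
    have h2 : genHarmonic (n + 1) = fun r => genHarmonic n r + a ^ r :=
      funext fun r => genHarmonic_succ n r
    rw [h2, powerSumSeries_add]
    have h3 := powerSumSeries_pow a
    -- Writing the old series as the new one times `1 - aX` avoids differentiating an inverse; this
    -- factor is cancelled below.
    rw [← h1] at ih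
    simp only [Derivation.leibniz, map_sub, smul_eq_mul,
      PowerSeries.derivative_C, PowerSeries.derivative_X] at ih
    simp at ih
    apply mul_right_cancel₀ (one_sub_C_mul_X_ne_zero a)
    linear_combination ih - complSeries (n + 1) * h3

theorem X_mul_derivative_elemSeries (n : ℕ) :
    PowerSeries.X * PowerSeries.derivative ℝ (elemSeries n) =
      powerSumSeries (fun i => -((-1) ^ i * genHarmonic n i)) * elemSeries n := by
  induction n with
  | zero =>
    have : powerSumSeries (fun i => -((-1) ^ i * genHarmonic 0 i)) = 0 := by
      ext i
      simp [powerSumSeries, genHarmonic]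
    simp [this, elemSeries]
  | succ n ih =>
    set a : ℝ := 1 / ((n : ℝ) + 1) with ha
    have h2 : (fun i => -((-1) ^ i * genHarmonic (n + 1) i)) =
        fun i => -((-1) ^ i * genHarmonic n i) + -(-a) ^ i := by
      funext i
      rw [genHarmonic_succ, ← ha, neg_pow a]
      ring
    rw [h2, powerSumSeries_add, powerSumSeries_neg (fun i => (-a) ^ i), elemSeries, ← ha]
    have h3 := powerSumSeries_pow (-a)
    simp only [map_neg, neg_mul, sub_neg_eq_add] at h3
    simp only [Derivation.leibniz, smul_eq_mul, map_add]
    simp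
    linear_combination (1 + PowerSeries.C a * PowerSeries.X) * ih + elemSeries n * h3

theorem coeff_zero_complSeries (n : ℕ) : PowerSeries.coeff 0 (complSeries n) = 1 := by
  induction n with
  | zero => simp [complSeries]
  | succ n ih => simpa [complSeries] using ih

theorem coeff_zero_elemSeries (n : ℕ) : PowerSeries.coeff 0 (elemSeries n) = 1 := by
  induction n with
  | zero => simp [elemSeries]
  | succ n ih => simpa [elemSeries] using ih

theorem aeval_genHarmonic_complPoly (n l : ℕ) :
    MvPolynomial.aeval (genHarmonic n) (complPoly l) = PowerSeries.coeff l (complSeries n) :=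
  aeval_complPoly_eq_coeff _ _ (coeff_zero_complSeries n) (X_mul_derivative_complSeries n) l

theorem aeval_genHarmonic_elemPoly (n k : ℕ) :
    MvPolynomial.aeval (genHarmonic n) (elemPoly k) = PowerSeries.coeff k (elemSeries n) := by
  rw [aeval_elemPoly]
  exact aeval_complPoly_eq_coeff _ _ (coeff_zero_elemSeries n) (X_mul_derivative_elemSeries n) k

theorem coeff_succ_complSeries_succ (n l : ℕ) :
    PowerSeries.coeff (l + 1) (complSeries (n + 1)) = PowerSeries.coeff (l + 1) (complSeries n) +
      1 / ((n : ℝ) + 1) * PowerSeries.coeff l (complSeries (n + 1)) := by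
  conv_rhs => rw [← complSeries_succ_mul n]
  rw [mul_sub, mul_one, ← mul_assoc, mul_comm _ (PowerSeries.C _), mul_assoc]
  simp [PowerSeries.coeff_succ_mul_X]

theorem coeff_succ_elemSeries_succ (n k : ℕ) :
    PowerSeries.coeff (k + 1) (elemSeries (n + 1)) = PowerSeries.coeff (k + 1) (elemSeries n) +
      1 / ((n : ℝ) + 1) * PowerSeries.coeff k (elemSeries n) := by
  rw [elemSeries, mul_add, mul_one, ← mul_assoc, mul_comm _ (PowerSeries.C _), mul_assoc]
  simp [PowerSeries.coeff_succ_mul_X]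

/-! ### The substitution `z = x + y` -/

/-- The coefficients of `a (1 - a x)⁻¹ ∑ f_i x^i`. -/
noncomputable def geomConv (a : ℝ≥0) (f : ℕ → ℝ≥0) : ℕ → ℝ≥0
  | 0 => a * f 0
  | i + 1 => a * (f (i + 1) + geomConv a f i)

/-- The coefficient of `x^i z^j` in `∏_{m ≤ n} (1 + z / (m - x))`. -/
noncomputable def chainCoeff : ℕ → ℕ → ℕ → ℝ≥0
  | 0, 0, 0 => 1
  | 0, _ + 1, _ => 0
  | 0, 0, _ + 1 => 0
  | n + 1, i, 0 => chainCoeff n i 0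
  | n + 1, i, j + 1 =>
    chainCoeff n i (j + 1) + geomConv (1 / ((n : ℝ≥0) + 1)) (fun s => chainCoeff n s j) i

/-- The coefficient of `x^i z^j` in `(n + 1 - x)⁻¹ ∏_{m ≤ n} (1 + z / (m - x))`. -/
noncomputable def chainStep (n i j : ℕ) : ℝ≥0 :=
  geomConv (1 / ((n : ℝ≥0) + 1)) (fun s => chainCoeff n s j) i

theorem chainCoeff_succ_zero (n i : ℕ) : chainCoeff (n + 1) i 0 = chainCoeff n i 0 := by
  rw [chainCoeff]

theorem chainCoeff_succ_succ (n i j : ℕ) :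
    chainCoeff (n + 1) i (j + 1) = chainCoeff n i (j + 1) + chainStep n i j := by
  rw [chainCoeff, chainStep]

theorem chainStep_zero (n j : ℕ) : chainStep n 0 j = 1 / ((n : ℝ≥0) + 1) * chainCoeff n 0 j := rfl

theorem chainStep_succ (n i j : ℕ) : chainStep n (i + 1) j =
    1 / ((n : ℝ≥0) + 1) * (chainCoeff n (i + 1) j + chainStep n i j) := rfl

/-- The sum of `C(j, k) f(i, j)` over `i + j = l + k`. -/
noncomputable def chooseSum (f : ℕ → ℕ → ℝ) (l k : ℕ) : ℝ :=
  ∑ p ∈ antidiagonal (l + k), (p.2.choose k : ℝ) * f p.1 p.2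

theorem chooseSum_add (f g : ℕ → ℕ → ℝ) (l k : ℕ) :
    chooseSum (fun i j => f i j + g i j) l k = chooseSum f l k + chooseSum g l k := by
  simp [chooseSum, mul_add, Finset.sum_add_distrib]

theorem chooseSum_mul (c : ℝ) (f : ℕ → ℕ → ℝ) (l k : ℕ) :
    chooseSum (fun i j => c * f i j) l k = c * chooseSum f l k := by
  simp only [chooseSum, Finset.mul_sum]
  exact Finset.sum_congr rfl fun _ _ => by ring

theorem sum_choose_mul_eq_zero (f : ℕ → ℕ → ℝ) {n k : ℕ} (h : n < k) :
    ∑ p ∈ antidiagonal n, (p.2.choose k : ℝ) * f p.1 p.2 = 0 := by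
  refine Finset.sum_eq_zero fun p hp => ?_
  have := HasAntidiagonal.mem_antidiagonal.1 hp
  rw [Nat.choose_eq_zero_of_lt (by omega)]
  simp

/-- `chooseSum f l k` is the coefficient of `x^l y^k` in `∑ f(i,j) x^i (x + y)^j`. If `f 0 j = 0`,
this series is divisible by `x`; dividing by `x` lowers `l`. -/
theorem chooseSum_zero_of_left_shift (f : ℕ → ℕ → ℝ) (h : ∀ j, f 0 j = 0) (k : ℕ) :
    chooseSum f 0 k = 0 := by
  rw [chooseSum, zero_add]
  cases k with
  | zero => simp [h]
  | succ k =>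
    rw [Finset.Nat.sum_antidiagonal_succ, h, mul_zero, zero_add]
    exact sum_choose_mul_eq_zero (fun i j => f (i + 1) j) (Nat.lt_succ_self k)

theorem chooseSum_succ_of_left_shift (f : ℕ → ℕ → ℝ) (h : ∀ j, f 0 j = 0) (l k : ℕ) :
    chooseSum f (l + 1) k = chooseSum (fun i j => f (i + 1) j) l k := by
  rw [chooseSum, chooseSum, show l + 1 + k = l + k + 1 by omega,
    Finset.Nat.sum_antidiagonal_succ, h, mul_zero, zero_add]

/-- If `f i 0 = 0`, the series is divisible by `x + y`. The four cases record multiplication by `x +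
y`, that is, Pascal's rule and its boundary cases. -/
theorem chooseSum_zero_zero_of_right_shift (f : ℕ → ℕ → ℝ) (h : ∀ i, f i 0 = 0) :
    chooseSum f 0 0 = 0 := by
  simp [chooseSum, h]

theorem chooseSum_zero_succ_of_right_shift (f : ℕ → ℕ → ℝ) (h : ∀ i, f i 0 = 0) (k : ℕ) :
    chooseSum f 0 (k + 1) = chooseSum (fun i j => f i (j + 1)) 0 k := by
  rw [chooseSum, chooseSum, zero_add, zero_add, Finset.Nat.sum_antidiagonal_succ', h, mul_zero,
    zero_add]
  simp only [Nat.choose_succ_succ, Nat.cast_add, add_mul, Finset.sum_add_distrib]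
  rw [sum_choose_mul_eq_zero (fun i j => f i (j + 1)) (Nat.lt_succ_self k), add_zero]

theorem chooseSum_succ_zero_of_right_shift (f : ℕ → ℕ → ℝ) (h : ∀ i, f i 0 = 0) (l : ℕ) :
    chooseSum f (l + 1) 0 = chooseSum (fun i j => f i (j + 1)) l 0 := by
  rw [chooseSum, chooseSum, add_zero, add_zero, Finset.Nat.sum_antidiagonal_succ', h, mul_zero,
    zero_add]
  simp

theorem chooseSum_succ_succ_of_right_shift (f : ℕ → ℕ → ℝ) (h : ∀ i, f i 0 = 0) (l k : ℕ) :
    chooseSum f (l + 1) (k + 1) =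
      chooseSum (fun i j => f i (j + 1)) l (k + 1) +
        chooseSum (fun i j => f i (j + 1)) (l + 1) k := by
  simp only [chooseSum]
  rw [show l + 1 + (k + 1) = l + 1 + k + 1 by omega, Finset.Nat.sum_antidiagonal_succ', h,
    mul_zero, zero_add, show l + (k + 1) = l + 1 + k by omega]
  simp only [Nat.choose_succ_succ, Nat.cast_add, add_mul, Finset.sum_add_distrib]
  rw [add_comm]

/-- With `a = 1/(n+1)`, the step series `S` solves `S = a (c_n + x S)`, and `a (1 - ax)⁻¹` times the
product for `n` solves the same equation. The auxiliary `g` is `x S`. -/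
theorem chooseSum_chainStep (n l k : ℕ)
    (ih : ∀ l, chooseSum (fun i j => (chainCoeff n i j : ℝ)) l k =
      PowerSeries.coeff l (complSeries n) * PowerSeries.coeff k (elemSeries n)) :
    chooseSum (fun i j => (chainStep n i j : ℝ)) l k =
      1 / ((n : ℝ) + 1) * PowerSeries.coeff l (complSeries (n + 1)) *
        PowerSeries.coeff k (elemSeries n) := by
  let g : ℕ → ℕ → ℝ := fun i j => match i with
    | 0 => 0
    | i + 1 => chainStep n i j
  have hg : (fun i j => (chainStep n i j : ℝ)) =
      fun i j => 1 / ((n : ℝ) + 1) * ((chainCoeff n i j : ℝ) + g i j) := by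
    funext i j
    cases i with
    | zero => simp [g, chainStep_zero]
    | succ i => simp [g, chainStep_succ]
  rw [hg, chooseSum_mul, chooseSum_add, ih]
  induction l with
  | zero =>
    rw [chooseSum_zero_of_left_shift g (fun j => rfl), coeff_zero_complSeries,
      coeff_zero_complSeries]
    ring
  | succ l ihl =>
    rw [chooseSum_succ_of_left_shift g (fun j => rfl), coeff_succ_complSeries_succ]
    have : chooseSum (fun i j => g (i + 1) j) l k =
        chooseSum (fun i j => (chainStep n i j : ℝ)) l k := rfl
    rw [this, hg, chooseSum_mul, chooseSum_add, ih, ihl]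
    ring

/-- The induction step is `(1 + ay)/(1 - ax) = 1 + (x + y) a/(1 - ax)` with `a = 1/(n+1)`; here `g`
is `z` times the step series. -/
theorem chooseSum_chainCoeff (n l k : ℕ) :
    chooseSum (fun i j => (chainCoeff n i j : ℝ)) l k =
      PowerSeries.coeff l (complSeries n) * PowerSeries.coeff k (elemSeries n) := by
  induction n generalizing l k with
  | zero =>
    have h0 : ∀ i j, (chainCoeff 0 i j : ℝ) = if i = 0 ∧ j = 0 then 1 else 0 := by
      intro i j
      cases i <;> cases j <;> simp [chainCoeff]
    simp only [chooseSum, complSeries, elemSeries, PowerSeries.coeff_one, h0]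
    rcases l with _ | l
    · rcases k with _ | k
      · rw [zero_add, Finset.Nat.antidiagonal_zero, sum_singleton]
        simp
      · rw [zero_add, sum_eq_zero]
        · simp
        · intro p hp
          have := mem_antidiagonal.1 hp
          rw [if_neg (by omega)]
          simp
    · rw [sum_eq_zero]
      · simp
      · intro p hp
        have := mem_antidiagonal.1 hp
        rw [if_neg (by omega)]
        simp
  | succ n ih =>
    let g : ℕ → ℕ → ℝ := fun i j => match j with
      | 0 => 0
      | j + 1 => chainStep n i j
    have hg : (fun i j => (chainCoeff (n + 1) i j : ℝ)) =
        fun i j => (chainCoeff n i j : ℝ) + g i j := by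
      funext i j
      cases j with
      | zero => simp [g, chainCoeff_succ_zero]
      | succ j => simp [g, chainCoeff_succ_succ]
    have hg' : (fun i j => g i (j + 1)) = fun i j => (chainStep n i j : ℝ) := rfl
    rw [hg, chooseSum_add, ih]
    rcases l with _ | l <;> rcases k with _ | k
    · rw [chooseSum_zero_zero_of_right_shift g (fun _ => rfl)]
      simp only [coeff_zero_complSeries, coeff_zero_elemSeries]
      ring
    · rw [chooseSum_zero_succ_of_right_shift g (fun _ => rfl), hg',
        chooseSum_chainStep n 0 k fun l => ih l k]
      simp only [coeff_zero_complSeries, coeff_succ_elemSeries_succ]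
      ring
    · rw [chooseSum_succ_zero_of_right_shift g (fun _ => rfl), hg',
        chooseSum_chainStep n l 0 fun l => ih l 0]
      simp only [coeff_zero_elemSeries, coeff_succ_complSeries_succ]
      ring
    · rw [chooseSum_succ_succ_of_right_shift g (fun _ => rfl), hg',
        chooseSum_chainStep n l (k + 1) fun l => ih l (k + 1),
        chooseSum_chainStep n (l + 1) k fun l => ih l k]
      simp only [coeff_succ_elemSeries_succ, coeff_succ_complSeries_succ]
      ring

theorem aeval_complPoly_mul_aeval_elemPoly (n l k : ℕ) :
    MvPolynomial.aeval (genHarmonic n) (complPoly l) *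
      MvPolynomial.aeval (genHarmonic n) (elemPoly k) =
      ∑ p ∈ antidiagonal (l + k), (p.2.choose k : ℝ) * (chainCoeff n p.1 p.2 : ℝ) := by
  rw [aeval_genHarmonic_complPoly, aeval_genHarmonic_elemPoly, ← chooseSum_chainCoeff]
  rfl

/-! ### Tail sums in `ℝ≥0∞` -/

/-- The sum of `f n` over `n > j`. -/
noncomputable def tailSum (f : ℕ → ℝ≥0∞) (j : ℕ) : ℝ≥0∞ := ∑' n, if j < n then f n else 0

theorem tailSum_congr {f g : ℕ → ℝ≥0∞} {j : ℕ} (h : ∀ n, j < n → f n = g n) :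
    tailSum f j = tailSum g j := by
  refine tsum_congr fun n => ?_
  by_cases hn : j < n
  · simp [hn, h n hn]
  · simp [hn]

theorem tailSum_mono {f g : ℕ → ℝ≥0∞} {j : ℕ} (h : ∀ n, j < n → f n ≤ g n) :
    tailSum f j ≤ tailSum g j := by
  refine ENNReal.tsum_le_tsum fun n => ?_
  by_cases hn : j < n
  · simpa [hn] using h n hn
  · simp [hn]

theorem tailSum_mul_left (c : ℝ≥0∞) (f : ℕ → ℝ≥0∞) (j : ℕ) :
    tailSum (fun n => c * f n) j = c * tailSum f j := by
  simp only [tailSum, ← ENNReal.tsum_mul_left, mul_ite, mul_zero]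

theorem tailSum_add (f g : ℕ → ℝ≥0∞) (j : ℕ) :
    tailSum (fun n => f n + g n) j = tailSum f j + tailSum g j := by
  simp only [tailSum, ← ENNReal.tsum_add]
  refine tsum_congr fun n => ?_
  by_cases hn : j < n <;> simp [hn]

theorem tailSum_tsum {ι : Type*} (f : ℕ → ι → ℝ≥0∞) (j : ℕ) :
    tailSum (fun n => ∑' x, f n x) j = ∑' x, tailSum (fun n => f n x) j := by
  simp only [tailSum]
  rw [ENNReal.tsum_comm]
  refine tsum_congr fun n => ?_
  by_cases hn : j < n <;> simp [hn]

theorem tailSum_finset_sum {ι : Type*} (s : Finset ι) (f : ℕ → ι → ℝ≥0∞) (j : ℕ) :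
    tailSum (fun n => ∑ x ∈ s, f n x) j = ∑ x ∈ s, tailSum (fun n => f n x) j := by
  simp only [tailSum]
  rw [← Summable.tsum_finsetSum fun _ _ => ENNReal.summable]
  refine tsum_congr fun n => ?_
  by_cases hn : j < n <;> simp [hn]

theorem tailSum_comm (f : ℕ → ℕ → ℝ≥0∞) (j k : ℕ) :
    tailSum (fun m => tailSum (fun n => f m n) j) k =
      tailSum (fun n => tailSum (fun m => f m n) k) j := by
  conv_lhs => rw [show (fun m => tailSum (fun n => f m n) j) =
    fun m => ∑' n, if j < n then f m n else 0 from rfl]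
  rw [tailSum_tsum]
  refine tsum_congr fun n => ?_
  by_cases hn : j < n <;> simp [hn, tailSum]

theorem tailSum_eq_tsum (f : ℕ → ℝ≥0∞) (j : ℕ) : tailSum f j = ∑' t, f (j + 1 + t) := by
  rw [tailSum, ← (add_right_injective (j + 1)).tsum_eq]
  · refine tsum_congr fun t => ?_
    rw [if_pos (by omega)]
  · intro n hn
    have : j < n := by
      by_contra h
      simp [h] at hn
    exact ⟨n - (j + 1), by simp; omega⟩

theorem tailSum_zero_eq_tsum (f : ℕ → ℝ≥0∞) : tailSum f 0 = ∑' t, f (t + 1) := by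
  rw [tailSum_eq_tsum]
  exact tsum_congr fun t => by rw [zero_add, add_comm]

/-! ### The connector and its transport relation -/

/-- The shifted factorial `∏_{i = 1}^n (i - z)`. -/
noncomputable def shiftedFactorial (z : ℝ) : ℕ → ℝ
  | 0 => 1
  | n + 1 => shiftedFactorial z n * ((n : ℝ) + 1 - z)

theorem shiftedFactorial_pos {z : ℝ} (hz : z < 1) (n : ℕ) : 0 < shiftedFactorial z n := by
  induction n with
  | zero => simp [shiftedFactorial]
  | succ n ih =>
    have : (0 : ℝ) ≤ n := n.cast_nonneg
    exact mul_pos ih (by linarith)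

/-- The connector of two series. -/
noncomputable def connector (z : ℝ) (m n : ℕ) : ℝ :=
  shiftedFactorial z m * shiftedFactorial z n / shiftedFactorial z (m + n)

theorem connector_comm (z : ℝ) (m n : ℕ) : connector z m n = connector z n m := by
  rw [connector, connector, mul_comm, add_comm]

theorem connector_zero_left {z : ℝ} (hz : z < 1) (n : ℕ) : connector z 0 n = 1 := by
  rw [connector, zero_add, shiftedFactorial, one_mul, div_self (shiftedFactorial_pos hz n).ne']

theorem connector_nonneg {z : ℝ} (hz : z < 1) (m n : ℕ) : 0 ≤ connector z m n :=
  div_nonneg (mul_nonneg (shiftedFactorial_pos hz m).le (shiftedFactorial_pos hz n).le)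
    (shiftedFactorial_pos hz _).le

theorem connector_succ_right {z : ℝ} (hz : z < 1) (m n : ℕ) :
    connector z m (n + 1) * ((m : ℝ) + n + 1 - z) = connector z m n * ((n : ℝ) + 1 - z) := by
  have h1 := (shiftedFactorial_pos hz (m + n)).ne'
  have hm : (0 : ℝ) ≤ m := m.cast_nonneg
  have hn : (0 : ℝ) ≤ n := n.cast_nonneg
  have h2 : (m : ℝ) + n + 1 - z ≠ 0 := by linarith
  rw [connector, connector, ← add_assoc m n 1, shiftedFactorial, shiftedFactorial]
  push_cast
  field_simp

theorem connector_succ_left_le {z : ℝ} (hz : z < 1) (m n : ℕ) :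
    connector z (m + 1) n ≤ connector z m n := by
  have h := connector_succ_right hz n m
  rw [connector_comm z n, connector_comm z n] at h
  have hm : (0 : ℝ) ≤ m := m.cast_nonneg
  have hn : (0 : ℝ) ≤ n := n.cast_nonneg
  have h0 := connector_nonneg hz m n
  have h1 := connector_nonneg hz (m + 1) n
  have h2 : 0 < (m : ℝ) + 1 - z := by linarith
  refine le_of_mul_le_mul_right ?_ h2
  rw [← h]
  exact mul_le_mul_of_nonneg_left (by linarith) h1

/-- The connector decreases in its first argument, and `C(1,n) = (1 - z)/(n + 1 - z)`. -/
theorem connector_succ_le {z : ℝ} (hz0 : 0 ≤ z) (hz : z < 1) (m n : ℕ) :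
    connector z (m + 1) n ≤ 1 / ((n : ℝ) + 1 - z) := by
  have hn : (0 : ℝ) ≤ n := n.cast_nonneg
  induction m with
  | zero =>
    have h := connector_succ_right hz n 0
    rw [connector_comm z n, connector_comm z n, connector_zero_left hz] at h
    push_cast at h
    rw [le_div_iff₀ (by linarith)]
    linarith
  | succ m ih => exact (connector_succ_left_le hz _ n).trans ih

theorem tendsto_connector {z : ℝ} (hz0 : 0 ≤ z) (hz : z < 1) (m : ℕ) :
    Filter.Tendsto (fun n => connector z (m + 1) n) Filter.atTop (nhds 0) := by
  refine squeeze_zero (fun n => connector_nonneg hz _ n) (fun n => connector_succ_le hz0 hz m n) ?_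
  simp only [one_div]
  refine Filter.Tendsto.inv_tendsto_atTop ?_
  have : (fun n : ℕ => (n : ℝ) + 1 - z) = fun n : ℕ => (n : ℝ) + (1 - z) := by
    funext n
    ring
  rw [this]
  exact Filter.tendsto_atTop_add_const_right _ _ tendsto_natCast_atTop_atTop

/-- The sum telescopes: `C(m,n-1) - C(m,n) = m C(m,n)/(n - z)`, and `C(m,n)` tends to `0` for `m ≥
1`. -/
theorem hasSum_connector {z : ℝ} (hz0 : 0 ≤ z) (hz : z < 1) (m a : ℕ) :
    HasSum (fun t : ℕ => connector z (m + 1) (a + 1 + t) * (1 / (((a + 1 + t : ℕ) : ℝ) - z)))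
      (connector z (m + 1) a * (1 / ((m : ℝ) + 1))) := by
  have hm : (0 : ℝ) < (m : ℝ) + 1 := by positivity
  have hterm : ∀ t : ℕ, 0 < ((a + 1 + t : ℕ) : ℝ) - z := fun t => by
    push_cast
    have h1 : (0 : ℝ) ≤ a := a.cast_nonneg
    have h2 : (0 : ℝ) ≤ t := t.cast_nonneg
    linarith
  rw [hasSum_iff_tendsto_nat_of_nonneg fun t => mul_nonneg (connector_nonneg hz _ _)
    (one_div_pos.2 (hterm t)).le]
  have hsum : ∀ n : ℕ, ∑ t ∈ range n, connector z (m + 1) (a + 1 + t) *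
      (1 / (((a + 1 + t : ℕ) : ℝ) - z)) = connector z (m + 1) a * (1 / ((m : ℝ) + 1)) -
        connector z (m + 1) (a + n) * (1 / ((m : ℝ) + 1)) := by
    intro n
    induction n with
    | zero => simp
    | succ n ih =>
      rw [Finset.sum_range_succ, ih]
      have h := connector_succ_right hz (m + 1) (a + n)
      have h3 := hterm n
      rw [show a + (n + 1) = a + 1 + n by omega, show a + 1 + n = a + n + 1 by omega] at *
      have h4 : ((a + n + 1 : ℕ) : ℝ) - z ≠ 0 := h3.ne'
      push_cast at h h4 ⊢
      field_simp
      linarith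
  simp only [hsum]
  have h := ((tendsto_connector hz0 hz m).comp (Filter.tendsto_add_atTop_nat a)).mul_const
    (1 / ((m : ℝ) + 1))
  have h' := h.const_sub (connector z (m + 1) a * (1 / ((m : ℝ) + 1)))
  simp only [zero_mul, sub_zero, Function.comp_def] at h'
  simpa only [add_comm a] using h'

/-- The connector as an extended nonnegative real. -/
noncomputable def eConnector (z : ℝ) (m n : ℕ) : ℝ≥0∞ := ENNReal.ofReal (connector z m n)

/-- The weight `1 / (n - z)` as an extended nonnegative real. -/
noncomputable def shiftedInv (z : ℝ) (n : ℕ) : ℝ≥0∞ := ENNReal.ofReal (1 / ((n : ℝ) - z))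

theorem inv_natCast_eq_ofReal {n : ℕ} (hn : 0 < n) :
    ((n : ℝ≥0∞))⁻¹ = ENNReal.ofReal (1 / (n : ℝ)) := by
  rw [one_div, ENNReal.ofReal_inv_of_pos (by positivity), ENNReal.ofReal_natCast]

theorem shiftedInv_zero {n : ℕ} (hn : 0 < n) : shiftedInv 0 n = (n : ℝ≥0∞)⁻¹ := by
  rw [shiftedInv, sub_zero, inv_natCast_eq_ofReal hn]

theorem eConnector_comm (z : ℝ) (m n : ℕ) : eConnector z m n = eConnector z n m := by
  rw [eConnector, eConnector, connector_comm]

theorem eConnector_zero_left {z : ℝ} (hz : z < 1) (n : ℕ) : eConnector z 0 n = 1 := by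
  simp [eConnector, connector_zero_left hz]

theorem tailSum_eConnector {z : ℝ} (hz0 : 0 ≤ z) (hz : z < 1) {m : ℕ} (hm : 0 < m) (a : ℕ) :
    tailSum (fun n => eConnector z m n * shiftedInv z n) a =
      (m : ℝ≥0∞)⁻¹ * eConnector z m a := by
  obtain ⟨m, rfl⟩ : ∃ k, m = k + 1 := ⟨m - 1, by omega⟩
  have h := hasSum_connector hz0 hz m a
  have hterm : ∀ t : ℕ, 0 ≤ 1 / (((a + 1 + t : ℕ) : ℝ) - z) := fun t => by
    push_cast
    have h1 : (0 : ℝ) ≤ a := a.cast_nonneg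
    have h2 : (0 : ℝ) ≤ t := t.cast_nonneg
    exact one_div_nonneg.2 (by linarith)
  rw [tailSum_eq_tsum, inv_natCast_eq_ofReal hm, mul_comm, eConnector,
    ← ENNReal.ofReal_mul (connector_nonneg hz _ _)]
  push_cast
  rw [← h.tsum_eq, ENNReal.ofReal_tsum_of_nonneg (fun t => mul_nonneg (connector_nonneg hz _ _)
    (hterm t)) h.summable]
  exact tsum_congr fun t => by
    rw [eConnector, shiftedInv, ENNReal.ofReal_mul (connector_nonneg hz _ _)]

/-! ### The sum theorem by connected sums -/

/-- The generating function, in the excess weight, of the sums of truncated multiple zeta values of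
depth `i + 1` with all summation variables greater than `j`. -/
noncomputable def truncSumGen (z : ℝ) : ℕ → ℕ → ℝ≥0∞
  | 0, j => tailSum (fun n => shiftedInv z n * (n : ℝ≥0∞)⁻¹) j
  | i + 1, j => tailSum (fun n => shiftedInv z n * truncSumGen z i n) j

theorem tailSum_eConnector_mul_eq_truncSumGen {z : ℝ} (hz0 : 0 ≤ z) (hz : z < 1) (i j : ℕ) :
    tailSum (fun m => (m : ℝ≥0∞)⁻¹ ^ (i + 1) * shiftedInv z m * eConnector z m j) 0 =
      truncSumGen z i j := by
  -- One transport: a factor `1/m` times `C(m,j)` becomes a new variable `n > j` with weight `1/(n -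
  -- z)` and connector `C(m,n)`.
  have key : ∀ i j, tailSum (fun m => (m : ℝ≥0∞)⁻¹ ^ (i + 1) * shiftedInv z m *
      eConnector z m j) 0 = tailSum (fun n => shiftedInv z n *
        tailSum (fun m => (m : ℝ≥0∞)⁻¹ ^ i * shiftedInv z m * eConnector z m n) 0) j := by
    intro i j
    simp only [← tailSum_mul_left]
    rw [tailSum_comm]
    refine tailSum_congr fun m hm => ?_
    rw [pow_succ, show (m : ℝ≥0∞)⁻¹ ^ i * (m : ℝ≥0∞)⁻¹ * shiftedInv z m * eConnector z m j =
      ((m : ℝ≥0∞)⁻¹ ^ i * shiftedInv z m) * ((m : ℝ≥0∞)⁻¹ * eConnector z m j) by ring,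
      ← tailSum_eConnector hz0 hz hm, ← tailSum_mul_left]
    exact tailSum_congr fun n _ => by ring
  induction i generalizing j with
  | zero =>
    rw [key, truncSumGen]
    refine tailSum_congr fun n hn => ?_
    -- No power of `1/m` is left, so the relation is used with the roles of `m` and `n` exchanged;
    -- `C(n,0) = 1` leaves `1/n`.
    have h := tailSum_eConnector hz0 hz (show 0 < n by omega) 0
    rw [eConnector_comm, eConnector_zero_left hz, mul_one] at h
    rw [← h]
    congr 1
    refine tailSum_congr fun m _ => ?_
    rw [pow_zero, one_mul, mul_comm, eConnector_comm]
  | succ i ih =>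
    rw [key, truncSumGen]
    exact tailSum_congr fun n _ => by rw [ih]

theorem tailSum_eq_truncSumGen {z : ℝ} (hz0 : 0 ≤ z) (hz : z < 1) (i : ℕ) :
    tailSum (fun m => (m : ℝ≥0∞)⁻¹ ^ (i + 1) * shiftedInv z m) 0 = truncSumGen z i 0 := by
  rw [← tailSum_eConnector_mul_eq_truncSumGen hz0 hz]
  refine tailSum_congr fun m _ => ?_
  rw [eConnector_comm, eConnector_zero_left hz, mul_one]

/-- The sum of all truncated multiple zeta values of depth `i + 1` and weight `i + e + 2`, with
all summation variables greater than `j`. -/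
noncomputable def truncSum : ℕ → ℕ → ℕ → ℝ≥0∞
  | 0, e, j => tailSum (fun n => (n : ℝ≥0∞)⁻¹ ^ (e + 2)) j
  | i + 1, e, j =>
    tailSum (fun n => ∑ p ∈ antidiagonal e, (n : ℝ≥0∞)⁻¹ ^ (p.1 + 1) * truncSum i p.2 n) j

theorem shiftedInv_eq_tsum {z : ℝ} (hz0 : 0 ≤ z) (hz : z < 1) {n : ℕ} (hn : 0 < n) :
    shiftedInv z n = ∑' e : ℕ, ENNReal.ofReal z ^ e * (n : ℝ≥0∞)⁻¹ ^ (e + 1) := by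
  have hn' : (1 : ℝ) ≤ n := by exact_mod_cast hn
  have h := (hasSum_geometric_of_lt_one (r := z / n) (by positivity)
    ((div_lt_one (by linarith)).2 (by linarith))).mul_left (1 / (n : ℝ))
  have h1 : 1 / (n : ℝ) * (1 - z / n)⁻¹ = 1 / ((n : ℝ) - z) := by
    have : (n : ℝ) - z ≠ 0 := by linarith
    have h2 : (n : ℝ) ≠ 0 := by linarith
    have h3 : 1 - z / (n : ℝ) ≠ 0 := by
      rw [one_sub_div h2]
      exact div_ne_zero this h2
    field_simp
  rw [h1] at h
  rw [shiftedInv, ← h.tsum_eq, ENNReal.ofReal_tsum_of_nonneg (fun e => by positivity) h.summable]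
  refine tsum_congr fun e => ?_
  rw [inv_natCast_eq_ofReal hn, ← ENNReal.ofReal_pow hz0, ← ENNReal.ofReal_pow (by positivity),
    ← ENNReal.ofReal_mul (by positivity)]
  congr 1
  rw [div_pow, div_pow, one_pow, pow_succ]
  field_simp

theorem ennreal_tsum_mul_tsum (f g : ℕ → ℝ≥0∞) :
    (∑' a, f a) * ∑' b, g b = ∑' e, ∑ p ∈ antidiagonal e, f p.1 * g p.2 := by
  rw [← ENNReal.tsum_mul_right]
  simp only [← ENNReal.tsum_mul_left]
  rw [← ENNReal.tsum_prod, ← Finset.HasAntidiagonal.sigmaAntidiagonalEquivProd.tsum_eq, ENNReal.tsum_sigma']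
  refine tsum_congr fun e => ?_
  rw [tsum_fintype, ← Finset.sum_coe_sort (antidiagonal e)]
  rfl

theorem truncSumGen_eq_tsum {z : ℝ} (hz0 : 0 ≤ z) (hz : z < 1) (i j : ℕ) :
    truncSumGen z i j = ∑' e, ENNReal.ofReal z ^ e * truncSum i e j := by
  induction i generalizing j with
  | zero =>
    simp only [truncSumGen, truncSum, ← tailSum_mul_left]
    rw [← tailSum_tsum]
    refine tailSum_congr fun n hn => ?_
    rw [shiftedInv_eq_tsum hz0 hz (by omega), ← ENNReal.tsum_mul_right]
    exact tsum_congr fun e => by ring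
  | succ i ih =>
    simp only [truncSumGen, truncSum, ← tailSum_mul_left]
    rw [← tailSum_tsum]
    refine tailSum_congr fun n hn => ?_
    rw [shiftedInv_eq_tsum hz0 hz (by omega), ih, ennreal_tsum_mul_tsum]
    refine tsum_congr fun e => ?_
    rw [Finset.mul_sum]
    refine Finset.sum_congr rfl fun p hp => ?_
    rw [← mem_antidiagonal.1 hp, pow_add]
    ring

/-- The zeta value `∑_{n ≥ 1} n^{-s}` as an extended nonnegative real. -/
noncomputable def eZeta (s : ℕ) : ℝ≥0∞ := tailSum (fun n => (n : ℝ≥0∞)⁻¹ ^ s) 0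

theorem tsum_eZeta_eq_tsum_truncSum {z : ℝ} (hz0 : 0 ≤ z) (hz : z < 1) (i : ℕ) :
    ∑' e, ENNReal.ofReal z ^ e * truncSum i e 0 = ∑' e, ENNReal.ofReal z ^ e * eZeta (i + e + 2) := by
  rw [← truncSumGen_eq_tsum hz0 hz, ← tailSum_eq_truncSumGen hz0 hz]
  simp only [eZeta, ← tailSum_mul_left]
  rw [← tailSum_tsum]
  refine tailSum_congr fun n hn => ?_
  rw [shiftedInv_eq_tsum hz0 hz hn, ← ENNReal.tsum_mul_left]
  exact tsum_congr fun e => by ring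

theorem eZeta_ne_top {s : ℕ} (hs : 2 ≤ s) : eZeta s ≠ ∞ := by
  have h : Summable fun n : ℕ => 1 / (n : ℝ) ^ s := Real.summable_one_div_nat_pow.2 hs
  have h' := (summable_nat_add_iff 1).2 h
  rw [eZeta, tailSum_zero_eq_tsum]
  have : ∀ t : ℕ, ((t + 1 : ℕ) : ℝ≥0∞)⁻¹ ^ s =
      ENNReal.ofReal (1 / ((t + 1 : ℕ) : ℝ) ^ s) := fun t => by
    rw [inv_natCast_eq_ofReal t.succ_pos, ← ENNReal.ofReal_pow (by positivity), div_pow, one_pow]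
  rw [tsum_congr this]
  exact h'.tsum_ofReal_ne_top

theorem eZeta_le {s t : ℕ} (h : s ≤ t) : eZeta t ≤ eZeta s :=
  tailSum_mono fun n hn => pow_le_pow_right_of_le_one' (ENNReal.inv_le_one.2 (by
    exact_mod_cast hn)) h

theorem tsum_pow_mul_eq_add (x : ℝ≥0∞) (a : ℕ → ℝ≥0∞) :
    ∑' s, x ^ s * a s = a 0 + x * ∑' s, x ^ s * a (s + 1) := by
  rw [tsum_eq_zero_add' ENNReal.summable, pow_zero, one_mul, ← ENNReal.tsum_mul_left]
  congr 1
  exact tsum_congr fun s => by ring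

/-- Evaluating at `1/(n+2) → 0` isolates the constant terms; convergence at `1/2` bounds the
remainder of `b` uniformly. -/
theorem le_of_tsum_pow_mul_eq (a b : ℕ → ℝ≥0∞) (hb : ∑' s, (2 : ℝ≥0∞)⁻¹ ^ s * b s ≠ ∞)
    (h : ∀ n : ℕ, ∑' s, ((n + 2 : ℕ) : ℝ≥0∞)⁻¹ ^ s * a s =
      ∑' s, ((n + 2 : ℕ) : ℝ≥0∞)⁻¹ ^ s * b s) : a 0 ≤ b 0 := by
  have hM : ∑' s, (2 : ℝ≥0∞)⁻¹ ^ s * b (s + 1) ≠ ∞ := fun hM => by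
    rw [tsum_pow_mul_eq_add, hM, ENNReal.mul_top (by simp)] at hb
    simp at hb
  set M := ∑' s, (2 : ℝ≥0∞)⁻¹ ^ s * b (s + 1)
  have hle : ∀ n : ℕ, a 0 ≤ b 0 + ((n + 2 : ℕ) : ℝ≥0∞)⁻¹ * M := fun n => by
    calc a 0 ≤ ∑' s, ((n + 2 : ℕ) : ℝ≥0∞)⁻¹ ^ s * a s := by
          rw [tsum_pow_mul_eq_add]
          exact le_self_add
      _ = b 0 + ((n + 2 : ℕ) : ℝ≥0∞)⁻¹ * ∑' s, ((n + 2 : ℕ) : ℝ≥0∞)⁻¹ ^ s * b (s + 1) := by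
          rw [h, tsum_pow_mul_eq_add]
      _ ≤ _ := by
          gcongr
          refine ENNReal.tsum_le_tsum fun s => ?_
          gcongr
          push_cast
          exact le_add_self
  have hlim : Filter.Tendsto (fun n : ℕ => b 0 + ((n + 2 : ℕ) : ℝ≥0∞)⁻¹ * M) Filter.atTop
      (nhds (b 0 + 0 * M)) := by
    refine Filter.Tendsto.const_add _ (ENNReal.Tendsto.mul_const ?_ (Or.inr hM))
    exact ENNReal.tendsto_inv_nat_nhds_zero.comp (Filter.tendsto_add_atTop_nat 2)
  rw [zero_mul, add_zero] at hlim
  exact ge_of_tendsto' hlim hle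

/-- Two power series with nonnegative coefficients that agree at `1 / 2, 1 / 3, …` have the same
coefficients. -/
theorem eq_of_tsum_pow_mul_eq (e : ℕ) (a b : ℕ → ℝ≥0∞)
    (hb : ∑' s, (2 : ℝ≥0∞)⁻¹ ^ s * b s ≠ ∞)
    (h : ∀ n : ℕ, ∑' s, ((n + 2 : ℕ) : ℝ≥0∞)⁻¹ ^ s * a s =
      ∑' s, ((n + 2 : ℕ) : ℝ≥0∞)⁻¹ ^ s * b s) : a e = b e := by
  have ha : ∑' s, (2 : ℝ≥0∞)⁻¹ ^ s * a s ≠ ∞ := by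
    have := h 0
    simp only [zero_add, Nat.cast_ofNat] at this
    rwa [this]
  have h0 : a 0 = b 0 := le_antisymm (le_of_tsum_pow_mul_eq a b hb h)
    (le_of_tsum_pow_mul_eq b a ha fun n => (h n).symm)
  induction e generalizing a b with
  | zero => exact h0
  | succ e ih =>
    have hfin : ∀ c : ℕ → ℝ≥0∞, ∑' s, (2 : ℝ≥0∞)⁻¹ ^ s * c s ≠ ∞ →
        ∑' s, (2 : ℝ≥0∞)⁻¹ ^ s * c (s + 1) ≠ ∞ := fun c hc hM => by
      rw [tsum_pow_mul_eq_add, hM, ENNReal.mul_top (by simp)] at hc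
      simp at hc
    have hb0 : b 0 ≠ ∞ := fun hb0 => by
      rw [tsum_pow_mul_eq_add, hb0] at hb
      simp at hb
    have h' : ∀ n : ℕ, ∑' s, ((n + 2 : ℕ) : ℝ≥0∞)⁻¹ ^ s * a (s + 1) =
        ∑' s, ((n + 2 : ℕ) : ℝ≥0∞)⁻¹ ^ s * b (s + 1) := fun n => by
      have hn := h n
      rw [tsum_pow_mul_eq_add, tsum_pow_mul_eq_add _ b, h0, ENNReal.add_right_inj hb0] at hn
      exact (ENNReal.mul_right_inj (ENNReal.inv_ne_zero.2 (ENNReal.natCast_ne_top _))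
        (ENNReal.inv_ne_top.2 (by positivity))).1 hn
    refine ih (fun s => a (s + 1)) (fun s => b (s + 1)) (hfin b hb) h' (hfin a ha) ?_
    exact le_antisymm (le_of_tsum_pow_mul_eq _ _ (hfin b hb) h')
      (le_of_tsum_pow_mul_eq _ _ (hfin a ha) fun n => (h' n).symm)

/-- The sum theorem for multiple zeta values. -/
theorem truncSum_zero (i e : ℕ) : truncSum i e 0 = eZeta (i + e + 2) := by
  refine eq_of_tsum_pow_mul_eq e (fun e => truncSum i e 0) (fun e => eZeta (i + e + 2)) ?_ ?_
  -- At `z = 1/2` the series is dominated by `ζ(2)` times a geometric series.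
  · refine ne_top_of_le_ne_top ?_ (ENNReal.tsum_le_tsum fun s =>
      mul_le_mul_right (eZeta_le (show 2 ≤ i + s + 2 by omega)) ((2 : ℝ≥0∞)⁻¹ ^ s))
    rw [ENNReal.tsum_mul_right, ENNReal.tsum_geometric]
    exact ENNReal.mul_ne_top (by simp) (eZeta_ne_top le_rfl)
  · intro n
    have hz : 1 / ((n + 2 : ℕ) : ℝ) < 1 := by
      rw [div_lt_one (by positivity)]
      push_cast
      have : (0 : ℝ) ≤ n := n.cast_nonneg
      linarith
    have := tsum_eZeta_eq_tsum_truncSum (z := 1 / ((n + 2 : ℕ) : ℝ)) (by positivity) hz i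
    rwa [← inv_natCast_eq_ofReal (by omega)] at this

/-! ### Connected sums for the coefficients `c_n(i,j)`, at `z = 0` -/

theorem chainCoeff_eq_sum_chainStep (n i j : ℕ) :
    chainCoeff n i (j + 1) = ∑ s ∈ range n, chainStep s i j := by
  induction n with
  | zero => cases i <;> simp [chainCoeff]
  | succ n ih => rw [chainCoeff_succ_succ, ih, sum_range_succ]

theorem chainCoeff_zero_right (n i : ℕ) : chainCoeff n i 0 = if i = 0 then 1 else 0 := by
  induction n with
  | zero => cases i <;> simp [chainCoeff]
  | succ n ih => rw [chainCoeff_succ_zero, ih]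

theorem tailSum_connector_inv {m : ℕ} (hm : 0 < m) (a : ℕ) :
    tailSum (fun n => (n : ℝ≥0∞)⁻¹ * eConnector 0 n m) a = (m : ℝ≥0∞)⁻¹ * eConnector 0 a m := by
  rw [eConnector_comm, ← tailSum_eConnector le_rfl zero_lt_one hm]
  refine tailSum_congr fun n hn => ?_
  rw [shiftedInv_zero (by omega), mul_comm, eConnector_comm]

/-- The series of the coefficients `chainStep` with the connector as weight. -/
noncomputable def connectedStep (n i j : ℕ) : ℝ≥0∞ :=
  ∑' b : ℕ, eConnector 0 (b + 1) n * chainStep b i j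

/-- The series of the coefficients `chainCoeff` with the connector as weight. -/
noncomputable def connectedCoeff (n i j : ℕ) : ℝ≥0∞ :=
  ∑' b : ℕ, ((b + 1 : ℕ) : ℝ≥0∞)⁻¹ * eConnector 0 (b + 1) n * chainCoeff b i j

theorem tailSum_succ_eq (f : ℕ → ℝ≥0∞) (j : ℕ) :
    tailSum f (j + 1) = ∑' b, if j < b then f (b + 1) else 0 := by
  rw [tailSum, tsum_eq_zero_add' ENNReal.summable]
  simp

theorem tsum_mul_sum_range (w f : ℕ → ℝ≥0∞) :
    ∑' b, w b * ∑ s ∈ range b, f s = ∑' s, (∑' b, if s < b then w b else 0) * f s := by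
  simp only [← ENNReal.tsum_mul_right]
  rw [ENNReal.tsum_comm]
  refine tsum_congr fun b => ?_
  rw [tsum_eq_sum (s := range b), Finset.mul_sum]
  · refine Finset.sum_congr rfl fun s hs => ?_
    rw [if_pos (mem_range.1 hs)]
  · intro s hs
    rw [if_neg (by simpa using hs), zero_mul]

theorem connectedCoeff_zero_zero {n : ℕ} (hn : 0 < n) : connectedCoeff n 0 0 = (n : ℝ≥0∞)⁻¹ := by
  have h := tailSum_connector_inv hn 0
  rw [eConnector_zero_left zero_lt_one, mul_one, tailSum_zero_eq_tsum] at h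
  rw [← h, connectedCoeff]
  exact tsum_congr fun b => by simp [chainCoeff_zero_right]

theorem connectedCoeff_succ_zero (n i : ℕ) : connectedCoeff n (i + 1) 0 = 0 := by
  simp [connectedCoeff, chainCoeff_zero_right]

/-- Write `c_b(i,j+1)` as a sum of steps over `s < b`; transport then evaluates the sum over `b >
s`. -/
theorem connectedCoeff_succ {n : ℕ} (hn : 0 < n) (i j : ℕ) :
    connectedCoeff n i (j + 1) = (n : ℝ≥0∞)⁻¹ * connectedStep n i j := by
  simp only [connectedCoeff, connectedStep, chainCoeff_eq_sum_chainStep, ENNReal.ofNNReal_finsetSum]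
  rw [tsum_mul_sum_range, ← ENNReal.tsum_mul_left]
  refine tsum_congr fun s => ?_
  rw [← tailSum_succ_eq (fun b => (b : ℝ≥0∞)⁻¹ * eConnector 0 b n), tailSum_connector_inv hn,
    mul_assoc]

theorem coe_one_div_succ (b : ℕ) :
    ((1 / ((b : ℝ≥0) + 1) : ℝ≥0) : ℝ≥0∞) = ((b + 1 : ℕ) : ℝ≥0∞)⁻¹ := by
  rw [one_div, ENNReal.coe_inv (by positivity)]
  push_cast
  rfl

/-- The series `∑_{m > n} connectedStep m i j / m`. -/
noncomputable def connectedTail (i j n : ℕ) : ℝ≥0∞ :=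
  tailSum (fun m => (m : ℝ≥0∞)⁻¹ * connectedStep m i j) n

theorem connectedStep_zero (n j : ℕ) : connectedStep n 0 j = connectedCoeff n 0 j := by
  refine tsum_congr fun b => ?_
  rw [chainStep_zero, ENNReal.coe_mul, coe_one_div_succ]
  ring

/-- In the recursion for `chainStep`, the factor `1/(b+1)` before the previous step is transported
to a sum over `m > n`. -/
theorem connectedStep_succ (n i j : ℕ) :
    connectedStep n (i + 1) j = connectedCoeff n (i + 1) j + connectedTail i j n := by
  have h : connectedTail i j n =
      ∑' b : ℕ, ((b + 1 : ℕ) : ℝ≥0∞)⁻¹ * eConnector 0 (b + 1) n * chainStep b i j := by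
    simp only [connectedTail, connectedStep, ← ENNReal.tsum_mul_left]
    rw [tailSum_tsum]
    refine tsum_congr fun b => ?_
    rw [eConnector_comm 0 (b + 1) n, ← tailSum_connector_inv (show 0 < b + 1 by omega), mul_comm,
      ← tailSum_mul_left]
    refine tailSum_congr fun m _ => ?_
    rw [eConnector_comm]
    ring
  rw [h, connectedStep, connectedCoeff, ← ENNReal.tsum_add]
  refine tsum_congr fun b => ?_
  rw [chainStep_succ, ENNReal.coe_mul, coe_one_div_succ, ENNReal.coe_add]
  ring

theorem inv_mul_connectedStep_zero {n : ℕ} (hn : 0 < n) (e : ℕ) :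
    (n : ℝ≥0∞)⁻¹ * connectedStep n 0 e = (n : ℝ≥0∞)⁻¹ ^ (e + 2) := by
  induction e with
  | zero => rw [connectedStep_zero, connectedCoeff_zero_zero hn, zero_add, pow_two]
  | succ e ih => rw [connectedStep_zero, connectedCoeff_succ hn, ih, ← pow_succ']

/-- Each decrease of `e` yields a factor `1/n` and splits off one tail; the recursion stops because
`connectedCoeff n (i + 1) 0 = 0`. -/
theorem inv_mul_connectedStep_succ {n : ℕ} (hn : 0 < n) (i e : ℕ) :
    (n : ℝ≥0∞)⁻¹ * connectedStep n (i + 1) e =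
      ∑ p ∈ antidiagonal e, (n : ℝ≥0∞)⁻¹ ^ (p.1 + 1) * connectedTail i p.2 n := by
  induction e with
  | zero => simp [connectedStep_succ, connectedCoeff_succ_zero]
  | succ e ih =>
    rw [connectedStep_succ, connectedCoeff_succ hn, ih, Finset.Nat.sum_antidiagonal_succ, mul_add,
      Finset.mul_sum, add_comm]
    congr 1
    · simp
    · exact Finset.sum_congr rfl fun p _ => by ring

theorem connectedTail_eq_truncSum (i e n : ℕ) : connectedTail i e n = truncSum i e n := by
  induction i generalizing e n with
  | zero => exact tailSum_congr fun m hm => inv_mul_connectedStep_zero (by omega) e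
  | succ i ih =>
    refine tailSum_congr fun m hm => ?_
    rw [inv_mul_connectedStep_succ (by omega)]
    exact Finset.sum_congr rfl fun p _ => by rw [ih]

/-- The series `∑_n chainCoeff n i j / (n + 1)²`. -/
noncomputable def chainSeries (i j : ℕ) : ℝ≥0∞ :=
  ∑' b : ℕ, ((b + 1 : ℕ) : ℝ≥0∞)⁻¹ ^ 2 * chainCoeff b i j

/-- One of the two factors `1/(b+1)` is opened up as `∑_{n ≥ 1} C(n,b+1)/n`, which is transport from
`a = 0`. -/
theorem chainSeries_eq_tailSum (i j : ℕ) :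
    chainSeries i j = tailSum (fun n => (n : ℝ≥0∞)⁻¹ * connectedCoeff n i j) 0 := by
  simp only [connectedCoeff, ← ENNReal.tsum_mul_left]
  rw [tailSum_tsum]
  refine tsum_congr fun b => ?_
  have h := tailSum_connector_inv (show 0 < b + 1 by omega) 0
  rw [eConnector_zero_left zero_lt_one, mul_one] at h
  rw [pow_two]
  nth_rewrite 1 [← h]
  rw [mul_assoc, mul_comm, ← tailSum_mul_left]
  refine tailSum_congr fun n _ => ?_
  rw [eConnector_comm]
  ring

theorem chainSeries_zero (j : ℕ) : chainSeries 0 j = eZeta (j + 2) := by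
  rw [chainSeries_eq_tailSum]
  refine tailSum_congr fun n hn => ?_
  rw [← connectedStep_zero, inv_mul_connectedStep_zero hn]

/-- By `connectedStep_succ` the left side is the sum of `connectedStep n (i + 1) j / n` over `n ≥
1`, hence a full sum over fixed weight and depth, to which the sum theorem applies. The subtracted
part will be `S^R`. -/
theorem chainSeries_succ_add (i j : ℕ) :
    chainSeries (i + 1) j + tailSum (fun n => (n : ℝ≥0∞)⁻¹ * truncSum i j n) 0 =
      eZeta (i + 1 + j + 2) := by
  rw [← truncSum_zero, ← connectedTail_eq_truncSum, chainSeries_eq_tailSum, ← tailSum_add]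
  refine tailSum_congr fun n _ => ?_
  rw [connectedStep_succ, connectedTail_eq_truncSum, mul_add]

/-! ### Multiple zeta values and exponent strings -/

open Classical in
/-- The multiple zeta value of exponent string `i`, as an extended nonnegative real, with all
summation variables greater than `j`. -/
noncomputable def truncZeta {d : ℕ} (i : Fin d → ℕ) (j : ℕ) : ℝ≥0∞ :=
  ∑' n : Fin d → ℕ, if StrictAnti n ∧ ∀ s, j < n s then ∏ s, (n s : ℝ≥0∞)⁻¹ ^ i s else 0

theorem multiZeta_eq_toReal {d : ℕ} (i : Fin d → ℕ) : multiZeta i = (truncZeta i 0).toReal := by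
  classical
  have h : truncZeta i 0 = ∑' n : {n : Fin d → ℕ // StrictAnti n ∧ ∀ j, 1 ≤ n j},
      ∏ s, (n.1 s : ℝ≥0∞)⁻¹ ^ i s := by
    rw [truncZeta]
    refine Eq.trans (tsum_congr fun n => ?_)
      (tsum_subtype {n : Fin d → ℕ | StrictAnti n ∧ ∀ j, 1 ≤ n j}
        (fun n => ∏ s, (n s : ℝ≥0∞)⁻¹ ^ i s)).symm
    by_cases hn : StrictAnti n ∧ ∀ s, 0 < n s
    · rw [if_pos hn, Set.indicator_of_mem (show n ∈ {n : Fin d → ℕ | StrictAnti n ∧ ∀ j, 1 ≤ n j} from hn)]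
    · rw [if_neg hn, Set.indicator_of_notMem (show n ∉ {n : Fin d → ℕ | StrictAnti n ∧ ∀ j, 1 ≤ n j} from hn)]
  rw [h, ENNReal.tsum_toReal_eq, multiZeta]
  · refine tsum_congr fun n => ?_
    rw [ENNReal.toReal_prod]
    refine Finset.prod_congr rfl fun s _ => ?_
    simp
  · intro n
    refine ENNReal.prod_ne_top fun s _ => ENNReal.pow_ne_top (ENNReal.inv_ne_top.2 ?_)
    have := n.2.2 s
    exact_mod_cast (show n.1 s ≠ 0 by omega)

theorem strictAnti_snoc_iff {d : ℕ} (n : Fin d → ℕ) (m j : ℕ) :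
    (StrictAnti (Fin.snoc n m : Fin (d + 1) → ℕ) ∧
      ∀ s, j < (Fin.snoc n m : Fin (d + 1) → ℕ) s) ↔
      j < m ∧ StrictAnti n ∧ ∀ s, m < n s := by
  constructor
  · rintro ⟨h1, h2⟩
    refine ⟨by simpa using h2 (Fin.last d), fun s t hst => ?_, fun s => ?_⟩
    · simpa using h1 (show s.castSucc < t.castSucc from hst)
    · simpa using h1 (Fin.castSucc_lt_last s)
  · rintro ⟨h1, h2, h3⟩
    constructor
    · intro s t hst
      induction t using Fin.lastCases with
      | last =>
        obtain ⟨s, rfl⟩ := Fin.exists_castSucc_eq.2 hst.ne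
        simpa using h3 s
      | cast t =>
        obtain ⟨s, rfl⟩ := Fin.exists_castSucc_eq.2 (hst.trans (Fin.castSucc_lt_last t)).ne
        simpa using h2 hst
    · intro s
      induction s using Fin.lastCases with
      | last => simpa using h1
      | cast s => simpa using h1.trans (h3 s)

/-- The last exponent belongs to the smallest variable, which becomes the lower bound for the
others. -/
theorem truncZeta_snoc {d : ℕ} (i : Fin d → ℕ) (a j : ℕ) :
    truncZeta (Fin.snoc i a : Fin (d + 1) → ℕ) j =
      tailSum (fun n => (n : ℝ≥0∞)⁻¹ ^ a * truncZeta i n) j := by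
  classical
  rw [truncZeta, ← (Fin.snocEquiv fun _ => ℕ).tsum_eq, ENNReal.tsum_prod']
  refine tsum_congr fun m => ?_
  have h : ∀ n : Fin d → ℕ, (Fin.snocEquiv fun _ => ℕ) (m, n) = (Fin.snoc n m : Fin (d + 1) → ℕ) :=
    fun n => rfl
  simp only [h, strictAnti_snoc_iff, Fin.prod_univ_castSucc, Fin.snoc_castSucc, Fin.snoc_last]
  by_cases hm : j < m
  · simp only [hm, true_and, if_true, truncZeta, ← ENNReal.tsum_mul_left]
    refine tsum_congr fun n => ?_
    split_ifs
    · rw [mul_comm]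
    · simp
  · simp [hm]

theorem truncZeta_of_isEmpty (i : Fin 0 → ℕ) (j : ℕ) : truncZeta i j = 1 := by
  classical
  rw [truncZeta, tsum_eq_single (default : Fin 0 → ℕ) fun n hn => (hn (Subsingleton.elim _ _)).elim,
    if_pos ⟨fun s => s.elim0, fun s => s.elim0⟩]
  simp

/-- The exponent strings of positive integers with first entry at least `2`, of weight `w` and
depth `d`. -/
def admissibleStrings (w d : ℕ) : Finset (Fin d → ℕ) :=
  (Finset.Nat.antidiagonalTuple d w).filter fun i =>
    (∀ j, 1 ≤ i j) ∧ ∀ j : Fin d, j.val = 0 → 1 < i j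

theorem mem_admissibleStrings {w d : ℕ} {i : Fin d → ℕ} :
    i ∈ admissibleStrings w d ↔
      ∑ s, i s = w ∧ (∀ j, 1 ≤ i j) ∧ ∀ j : Fin d, j.val = 0 → 1 < i j := by
  rw [admissibleStrings, mem_filter, Finset.Nat.mem_antidiagonalTuple]

theorem snoc_mem_admissibleStrings_iff {w d a : ℕ} {i : Fin (d + 1) → ℕ} :
    (Fin.snoc i a : Fin (d + 2) → ℕ) ∈ admissibleStrings (w + a) (d + 2) ↔
      1 ≤ a ∧ i ∈ admissibleStrings w (d + 1) := by
  simp only [mem_admissibleStrings, Fin.sum_univ_castSucc (n := d + 1), Fin.forall_fin_succ']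
  simp
  tauto

theorem lt_sum_of_mem_admissibleStrings {w d : ℕ} {i : Fin (d + 1) → ℕ}
    (hi : i ∈ admissibleStrings w (d + 1)) : d + 2 ≤ w := by
  obtain ⟨h1, h2, h3⟩ := mem_admissibleStrings.1 hi
  rw [← h1, Fin.sum_univ_succ]
  have h4 := h3 0 rfl
  have h5 : ∑ _s : Fin d, 1 ≤ ∑ s : Fin d, i s.succ := Finset.sum_le_sum fun s _ => h2 _
  simp at h5
  omega

theorem sum_truncZeta (i e j : ℕ) :
    ∑ x ∈ admissibleStrings (i + e + 2) (i + 1), truncZeta x j = truncSum i e j := by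
  induction i generalizing e j with
  | zero =>
    have h : admissibleStrings (0 + e + 2) (0 + 1) =
        {(Fin.snoc (default : Fin 0 → ℕ) (e + 2) : Fin 1 → ℕ)} := by
      ext x
      rw [mem_admissibleStrings, mem_singleton]
      constructor
      · rintro ⟨h, -⟩
        funext s
        obtain rfl : s = 0 := Fin.ext (by have := s.2; simp)
        simpa [Fin.snoc] using h
      · rintro rfl
        simp [Fin.snoc]
    rw [h, sum_singleton, truncZeta_snoc, truncSum]
    exact tailSum_congr fun n _ => by rw [truncZeta_of_isEmpty, mul_one]
  | succ i ih =>
    rw [truncSum]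
    have h : ∀ n : ℕ, ∑ p ∈ antidiagonal e, (n : ℝ≥0∞)⁻¹ ^ (p.1 + 1) * truncSum i p.2 n =
        ∑ x ∈ (antidiagonal e).sigma fun p => admissibleStrings (i + p.2 + 2) (i + 1),
          (n : ℝ≥0∞)⁻¹ ^ (x.1.1 + 1) * truncZeta x.2 n := by
      intro n
      rw [Finset.sum_sigma]
      refine Finset.sum_congr rfl fun p _ => ?_
      rw [← ih, Finset.mul_sum]
    simp only [h]
    rw [tailSum_finset_sum]
    symm
    refine Finset.sum_bij'
      (fun x _ => (Fin.snoc x.2 (x.1.1 + 1) : Fin (i + 2) → ℕ))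
      (fun x _ => ⟨(x (Fin.last _) - 1, e + 1 - x (Fin.last _)), Fin.init x⟩) ?_ ?_ ?_ ?_ ?_
    · rintro ⟨p, x⟩ hx
      rw [mem_sigma, HasAntidiagonal.mem_antidiagonal] at hx
      have := snoc_mem_admissibleStrings_iff (a := p.1 + 1) |>.2 ⟨by omega, hx.2⟩
      have hp := hx.1
      dsimp only at hp
      rwa [show i + p.2 + 2 + (p.1 + 1) = i + 1 + e + 2 by omega] at this
    · intro x hx
      obtain ⟨y, a, rfl⟩ : ∃ (y : Fin (i + 1) → ℕ) (a : ℕ), x = Fin.snoc y a :=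
        ⟨Fin.init x, x (Fin.last _), (Fin.snoc_init_self x).symm⟩
      have hsum := (mem_admissibleStrings.1 hx).1
      rw [Fin.sum_univ_castSucc] at hsum
      simp only [Fin.snoc_castSucc, Fin.snoc_last] at hsum
      rw [show i + 1 + e + 2 = (∑ s, y s) + a by omega] at hx
      have hy := snoc_mem_admissibleStrings_iff.1 hx
      -- The weight of `y` is at least `i + 2`, hence `a ≤ e + 1` and the subtraction `e + 1 - a` is
      -- not truncated.
      have hlt := lt_sum_of_mem_admissibleStrings hy.2
      simp only [mem_sigma, HasAntidiagonal.mem_antidiagonal, Fin.snoc_last, Fin.init_snoc]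
      refine ⟨by omega, ?_⟩
      rw [show i + (e + 1 - a) + 2 = ∑ s, y s by omega]
      exact hy.2
    · rintro ⟨⟨p, q⟩, x⟩ hx
      rw [mem_sigma, HasAntidiagonal.mem_antidiagonal] at hx
      have := hx.1
      dsimp only at this
      subst this
      simp
    · intro x hx
      have := (mem_admissibleStrings.1 hx).2.1 (Fin.last _)
      dsimp only
      rw [Nat.sub_add_cancel this, Fin.snoc_init_self]
    · intro x hx
      rw [truncZeta_snoc]

theorem mem_stringsEndingInOne_iff {w d : ℕ} {x : Fin (d + 2) → ℕ} :
    x ∈ stringsEndingInOne w (d + 2) ↔ x ∈ admissibleStrings w (d + 2) ∧ x (Fin.last _) = 1 := by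
  have h : (∀ j : Fin (d + 2), j.val + 1 = d + 2 → x j = 1) ↔ x (Fin.last _) = 1 := by
    constructor
    · intro h
      exact h _ (by simp)
    · intro h j hj
      rwa [show j = Fin.last _ from Fin.ext (by simp; omega)]
  rw [stringsEndingInOne, mem_filter, h, admissibleStrings, mem_filter]
  tauto

/-- The factor `1/n` appends an exponent `1`, carried by a new smallest variable `n`. -/
theorem SR_eq_toReal (i e : ℕ) (hfin : tailSum (fun n => (n : ℝ≥0∞)⁻¹ * truncSum i e n) 0 ≠ ∞) :
    SR (i + e + 3) (i + 2) = (tailSum (fun n => (n : ℝ≥0∞)⁻¹ * truncSum i e n) 0).toReal := by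
  have h : tailSum (fun n => (n : ℝ≥0∞)⁻¹ * truncSum i e n) 0 =
      ∑ x ∈ stringsEndingInOne (i + e + 3) (i + 2), truncZeta x 0 := by
    simp only [← sum_truncZeta, Finset.mul_sum]
    rw [tailSum_finset_sum]
    refine Finset.sum_bij' (fun x _ => (Fin.snoc x 1 : Fin (i + 2) → ℕ)) (fun x _ => Fin.init x)
      ?_ ?_ ?_ ?_ ?_
    · intro x hx
      rw [mem_stringsEndingInOne_iff]
      exact ⟨snoc_mem_admissibleStrings_iff.2 ⟨le_rfl, hx⟩, by simp⟩
    · intro x hx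
      rw [mem_stringsEndingInOne_iff] at hx
      refine (snoc_mem_admissibleStrings_iff (a := 1).1 ?_).2
      have h := Fin.snoc_init_self x
      rw [hx.2] at h
      rw [h]
      exact hx.1
    · intro x hx
      simp
    · intro x hx
      rw [mem_stringsEndingInOne_iff] at hx
      have h := Fin.snoc_init_self x
      rwa [hx.2] at h
    · intro x hx
      simp only [truncZeta_snoc, pow_one]
  rw [h] at hfin ⊢
  rw [ENNReal.toReal_sum fun x hx => ?_, SR]
  · exact Finset.sum_congr rfl fun x _ => multiZeta_eq_toReal x
  · exact ne_top_of_le_ne_top hfin (Finset.single_le_sum (f := fun x => truncZeta x 0)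
      (fun _ _ => zero_le) hx)

/-! ### Evaluation of the series -/

theorem chainSeries_ne_top (i j : ℕ) : chainSeries i j ≠ ∞ := by
  cases i with
  | zero =>
    rw [chainSeries_zero]
    exact eZeta_ne_top (by omega)
  | succ i =>
    refine ne_top_of_le_ne_top (eZeta_ne_top (s := i + 1 + j + 2) (by omega)) ?_
    rw [← chainSeries_succ_add]
    exact le_self_add

theorem toReal_chainSeries_zero (j : ℕ) : (chainSeries 0 j).toReal = (eZeta (j + 2)).toReal := by
  rw [chainSeries_zero]

theorem toReal_chainSeries_succ (i j : ℕ) : (chainSeries (i + 1) j).toReal =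
    (eZeta (i + 1 + j + 2)).toReal - SR (i + j + 3) (i + 2) := by
  have hz : eZeta (i + 1 + j + 2) ≠ ∞ := eZeta_ne_top (by omega)
  have h := chainSeries_succ_add i j
  rw [← h] at hz
  have h2 := (ENNReal.add_ne_top.1 hz).2
  rw [SR_eq_toReal i j h2, ← h, ENNReal.toReal_add (chainSeries_ne_top _ _) h2, add_sub_cancel_right]

theorem riemannZeta_eq_eZeta (s : ℕ) :
    riemannZeta ((s + 2 : ℕ) : ℂ) = ((eZeta (s + 2)).toReal : ℂ) := by
  rw [zeta_nat_eq_tsum_of_gt_one (by omega), eZeta, tailSum, ENNReal.tsum_toReal_eq]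
  · rw [Complex.ofReal_tsum]
    refine tsum_congr fun n => ?_
    rcases Nat.eq_zero_or_pos n with rfl | hn
    · simp
    · simp [hn]
  · intro n
    split_ifs with hn
    · exact ENNReal.pow_ne_top (ENNReal.inv_ne_top.2 (by exact_mod_cast hn.ne'))
    · simp

theorem hasSum_chainCoeff (i j : ℕ) :
    HasSum (fun n : ℕ => (chainCoeff n i j : ℝ) / ((n : ℝ) + 1) ^ 2) (chainSeries i j).toReal := by
  have h := ENNReal.hasSum_toReal (chainSeries_ne_top i j)
  rw [chainSeries, ENNReal.tsum_toReal_eq fun n => ENNReal.mul_ne_top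
    (ENNReal.pow_ne_top (ENNReal.inv_ne_top.2 (by positivity))) ENNReal.coe_ne_top]
  convert h using 2 with n
  rw [ENNReal.toReal_mul, ENNReal.toReal_pow, ENNReal.toReal_inv, ENNReal.toReal_natCast,
    ENNReal.coe_toReal]
  push_cast
  rw [div_eq_mul_inv, inv_pow, mul_comm]

theorem sum_range_choose_eq_choose (n k : ℕ) :
    ∑ p ∈ range (n + 1), p.choose k = (n + 1).choose (k + 1) := by
  induction n with
  | zero => simp [Nat.choose_succ_succ]
  | succ n ih => rw [sum_range_succ, ih, Nat.choose_succ_succ (n + 1), add_comm]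

theorem hasSum_complPoly_mul_elemPoly (l k : ℕ) :
    HasSum (fun n : ℕ => MvPolynomial.aeval (genHarmonic n) (complPoly l) *
        MvPolynomial.aeval (genHarmonic n) (elemPoly k) / ((n : ℝ) + 1) ^ 2)
      (((l + k + 1).choose (k + 1) : ℝ) * (eZeta (l + k + 2)).toReal -
        ∑ p ∈ Ico k (l + k), (p.choose k : ℝ) * SR (l + k + 2) (l + k + 1 - p)) := by
  have h := hasSum_sum (s := antidiagonal (l + k)) fun p _ =>
    (hasSum_chainCoeff p.1 p.2).mul_left (p.2.choose k : ℝ)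
  have hf : ∀ n : ℕ, MvPolynomial.aeval (genHarmonic n) (complPoly l) *
      MvPolynomial.aeval (genHarmonic n) (elemPoly k) / ((n : ℝ) + 1) ^ 2 =
      ∑ p ∈ antidiagonal (l + k),
        (p.2.choose k : ℝ) * ((chainCoeff n p.1 p.2 : ℝ) / ((n : ℝ) + 1) ^ 2) := fun n => by
    rw [aeval_complPoly_mul_aeval_elemPoly, Finset.sum_div]
    exact Finset.sum_congr rfl fun p _ => by rw [mul_div_assoc]
  simp only [hf]
  suffices hval : ∑ p ∈ antidiagonal (l + k), (p.2.choose k : ℝ) * (chainSeries p.1 p.2).toReal =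
      ((l + k + 1).choose (k + 1) : ℝ) * (eZeta (l + k + 2)).toReal -
        ∑ p ∈ Ico k (l + k), (p.choose k : ℝ) * SR (l + k + 2) (l + k + 1 - p) by
    rw [← hval]
    exact h
  -- Reversing the sum makes `p` the exponent `j` of `z`, so that `i = l + k - p`; only `p = l + k`
  -- has `i = 0` and no `SR` term.
  rw [Finset.Nat.sum_antidiagonal_eq_sum_range_succ_mk, ← Finset.sum_range_reflect]
  have hterm : ∀ p ∈ range (l + k + 1),
      ((l + k - (l + k + 1 - 1 - p)).choose k : ℝ) *
        (chainSeries (l + k + 1 - 1 - p) (l + k - (l + k + 1 - 1 - p))).toReal =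
      (p.choose k : ℝ) * (eZeta (l + k + 2)).toReal -
        if p < l + k then (p.choose k : ℝ) * SR (l + k + 2) (l + k + 1 - p) else 0 := by
    intro p hp
    have hp' := mem_range.1 hp
    rw [show l + k - (l + k + 1 - 1 - p) = p by omega]
    by_cases h : p < l + k
    · obtain ⟨i, hi⟩ : ∃ i, l + k = i + 1 + p := ⟨l + k - p - 1, by omega⟩
      rw [if_pos h, show l + k + 1 - 1 - p = i + 1 by omega, toReal_chainSeries_succ,
        show l + k + 1 - p = i + 2 by omega, hi, show i + 1 + p + 2 = i + p + 3 by omega, mul_sub]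
    · rw [if_neg h, show l + k + 1 - 1 - p = 0 by omega, toReal_chainSeries_zero,
        show p = l + k by omega, sub_zero]
  rw [Finset.sum_congr rfl hterm, Finset.sum_sub_distrib, ← Finset.sum_mul]
  congr 1
  · congr 1
    exact_mod_cast sum_range_choose_eq_choose (l + k) k
  -- The terms with `p < k` vanish through the binomial coefficient.
  · rw [← Finset.sum_filter]
    symm
    apply Finset.sum_subset_zero_on_sdiff
    · intro p hp
      simp only [mem_Ico, mem_filter, mem_range] at hp ⊢
      omega
    · intro p hp
      simp only [mem_sdiff, mem_Ico, mem_filter, mem_range] at hp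
      rw [Nat.choose_eq_zero_of_lt (by omega)]
      simp
    · intro p _
      rfl

theorem mainTheorem9 (l k : ℕ) :
    HasSum
      (fun n : ℕ =>
        ((MvPolynomial.aeval (genHarmonic n) (complPoly l) *
            MvPolynomial.aeval (genHarmonic n) (elemPoly k) / ((n : ℝ) + 1) ^ 2 : ℝ) : ℂ))
      (((l + k + 1).choose (k + 1) : ℂ) * riemannZeta ((l + k + 2 : ℕ) : ℂ) -
        ((∑ p ∈ Finset.Ico k (l + k),
          (p.choose k : ℝ) * SR (l + k + 2) (l + k + 1 - p) : ℝ) : ℂ)) := by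
  have h := Complex.hasSum_ofReal.2 (hasSum_complPoly_mul_elemPoly l k)
  rw [riemannZeta_eq_eZeta]
  rw [Complex.ofReal_sub, Complex.ofReal_mul, Complex.ofReal_natCast] at h
  exact h
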